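/- Let $\mathcal H$ be a (real or complex) Hilbert space, let $\psi$ be a bounded normal operator on $\mathcal H$ (i.e. $\psi\psi^*=\psi^*\psi$), and let $s\in\mathcal H$. Consider the evolution $\Psi=(\psi,s)$ with states $s^{(t)}=\psi^t s$, $t=0,1,2,\dots$, and state averages $\overline{s}^{(t)}=\frac1t\sum_{m=1}^{t}\psi^m s$, $t\ge 1$. Call $\Psi$ *stable* if $\inf\{c\in\mathbb R : \|\psi^t s\|\le c\,\|s\| \text{ for all } t\ge 0\}<\infty$ (where $\inf\emptyset=\infty$), i.e. if the orbit $(\psi^t s)_{t\ge0}$ is bounded, and *mean ergodic* if the averages $\overline{s}^{(t)}$ converge in norm, as $t\to\infty$, to some vector in the closure of $\operatorname{lin}\{\psi^t s : t\ge 0\}$. Then the following are equivalent: (i) $\Psi$ is stable; (ii) $\Psi$ is mean ergodic. In this case the averages $\overline{s}^{(t)}$ converge in norm to the orthogonal projection of $s$ onto the closed subspace $E_1=\{x\in\mathcal H : \psi x=x\}$. -/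

import Mathlib

/-!
An evolution `(ψ, s)` is the sequence of states `ψ ^ t s`, `t = 0, 1, 2, …`, where `ψ` is a bounded
operator on a normed space over `𝕜 = ℝ` or `ℂ`.
-/

namespace Evolution

open Filter Topology

section Normed

variable {𝕜 E : Type*} [RCLike 𝕜] [NormedAddCommGroup E] [NormedSpace 𝕜 E]

/-- The state of the evolution `(ψ, s)` at time `t`. -/
def state (ψ : E →L[𝕜] E) (s : E) (t : ℕ) : E := (ψ ^ t) s

/-- The evolution space of `(ψ, s)`: the linear span of all its states. -/
def evolutionSpace (ψ : E →L[𝕜] E) (s : E) : Submodule 𝕜 E :=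
  Submodule.span 𝕜 (Set.range (state ψ s))

/-- The norm of the evolution: the infimum, in the extended reals, of all real `c` such that
`‖ψ ^ t s‖ ≤ c * ‖s‖` for all `t ≥ 0` (it is `⊤` if there is no such `c`). -/
noncomputable def evolutionNorm (ψ : E →L[𝕜] E) (s : E) : EReal :=
  sInf ((fun c : ℝ => (c : EReal)) '' {c : ℝ | ∀ t : ℕ, ‖state ψ s t‖ ≤ c * ‖s‖})

/-- The evolution is stable if its norm is less than `∞`. -/
def IsStable (ψ : E →L[𝕜] E) (s : E) : Prop := evolutionNorm ψ s < ⊤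

/-- The average of the states at times `1, …, t`, for `t ≥ 1`. -/
noncomputable def stateAverage (ψ : E →L[𝕜] E) (s : E) (t : ℕ) : E :=
  (t : 𝕜)⁻¹ • ∑ m ∈ Finset.Icc 1 t, state ψ s m

/-- The evolution is mean ergodic if its state averages converge in norm to some limit state in the
closure of the evolution space. -/
def IsMeanErgodic (ψ : E →L[𝕜] E) (s : E) : Prop :=
  ∃ x ∈ (evolutionSpace ψ s).topologicalClosure, Tendsto (stateAverage ψ s) atTop (𝓝 x)

/-- The space `{x | ψ x = x}` of fixed vectors (the eigenspace for the eigenvalue `1`, possibly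
zero). -/
def fixedSpace (ψ : E →L[𝕜] E) : Submodule 𝕜 E where
  carrier := {x | ψ x = x}
  add_mem' := by
    intro x y hx hy
    simp only [Set.mem_ofPred_eq] at hx hy ⊢
    rw [map_add, hx, hy]
  zero_mem' := map_zero ψ
  smul_mem' := by
    intro a x hx
    simp only [Set.mem_ofPred_eq] at hx ⊢
    rw [map_smul, hx]

theorem isClosed_fixedSpace (ψ : E →L[𝕜] E) : IsClosed (fixedSpace ψ : Set E) :=
  isClosed_eq ψ.continuous continuous_id

end Normed

section Hilbert

variable {𝕜 H : Type*} [RCLike 𝕜] [NormedAddCommGroup H] [InnerProductSpace 𝕜 H] [CompleteSpace H]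

instance hasOrthogonalProjection_fixedSpace (ψ : H →L[𝕜] H) :
    (fixedSpace ψ).HasOrthogonalProjection :=
  haveI : CompleteSpace (fixedSpace ψ) := (isClosed_fixedSpace ψ).completeSpace_coe
  inferInstance

end Hilbert

end Evolution

namespace Evolution

open Filter Topology

/-! For normal `ψ` the norms along an orbit are log-convex, so once they increase they grow
geometrically; linear growth therefore forces them never to increase. Convergent averages give
linear growth, hence stability with constant 1. Conversely, `ψ` is a contraction on the closure of
the bounded orbits, where von Neumann's mean ergodic theorem applies. The limit is the projection of
`s` because `ψ` and its adjoint have the same fixed vectors. -/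

/-- A nonnegative log-convex sequence of at most linear growth does not increase at the start. -/
theorem one_le_zero_of_logConvex_of_linear {a : ℕ → ℝ} (h0 : ∀ n, 0 ≤ a n)
    (hlog : ∀ n, a (n + 1) ^ 2 ≤ a n * a (n + 2)) {C : ℝ} (hC : ∀ n : ℕ, a n ≤ C * (n + 1)) :
    a 1 ≤ a 0 := by
  by_contra! hlt
  have hpos : 0 < a 0 := by
    refine (h0 0).lt_of_ne fun h => ?_
    have := hlog 0
    rw [← h, zero_mul] at this
    nlinarith [h0 0]
  set r := a 1 / a 0 with hr
  have hr1 : 1 < r := (one_lt_div hpos).2 hlt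
  -- Log-convexity makes successive ratios nondecreasing, so all are at least `r`; positivity is
  -- carried along to allow cancellation.
  have key : ∀ n, 0 < a n ∧ r * a n ≤ a (n + 1) := by
    intro n
    induction n with
    | zero => exact ⟨hpos, by rw [hr, div_mul_cancel₀ _ hpos.ne']⟩
    | succ n ih =>
      obtain ⟨hn, hn1⟩ := ih
      have hn' : 0 < a (n + 1) := lt_of_lt_of_le (by positivity) hn1
      refine ⟨hn', le_of_mul_le_mul_left ?_ hn⟩
      calc a n * (r * a (n + 1)) = (r * a n) * a (n + 1) := by ring
        _ ≤ a (n + 1) * a (n + 1) := by gcongr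
        _ ≤ a n * a (n + 1 + 1) := by rw [← sq]; exact hlog n
  have geom : ∀ n, a 0 * r ^ n ≤ a n := by
    intro n
    induction n with
    | zero => simp
    | succ n ih =>
      calc a 0 * r ^ (n + 1) = r * (a 0 * r ^ n) := by ring
        _ ≤ r * a n := by gcongr
        _ ≤ a (n + 1) := (key n).2
  have hlim : Tendsto (fun n : ℕ => C * ((n : ℝ) ^ 1 / r ^ n + (n : ℝ) ^ 0 / r ^ n)) atTop
      (𝓝 (C * (0 + 0))) :=
    ((tendsto_pow_const_div_const_pow_of_one_lt 1 hr1).add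
      (tendsto_pow_const_div_const_pow_of_one_lt 0 hr1)).const_mul C
  have hle : a 0 ≤ C * (0 + 0) := by
    refine ge_of_tendsto' hlim fun n => ?_
    have hrn : 0 < r ^ n := by positivity
    rw [← add_div, ← mul_div_assoc, le_div_iff₀ hrn, pow_one, pow_zero]
    exact (geom n).trans (hC n)
  simp at hle
  exact absurd hle hpos.not_ge

section Normed

variable {𝕜 E : Type*} [RCLike 𝕜] [NormedAddCommGroup E] [NormedSpace 𝕜 E]

theorem isStable_iff {ψ : E →L[𝕜] E} {s : E} :
    IsStable ψ s ↔ ∃ c : ℝ, ∀ t : ℕ, ‖state ψ s t‖ ≤ c * ‖s‖ := by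
  constructor
  · intro h
    obtain ⟨_, ⟨c, hc, rfl⟩, -⟩ := sInf_lt_iff.1 h
    exact ⟨c, hc⟩
  · rintro ⟨c, hc⟩
    exact sInf_lt_iff.2 ⟨_, ⟨c, hc, rfl⟩, EReal.coe_lt_top c⟩

/-- Birkhoff averages start at time 0 and state averages at time 1, hence the base point `ψ s`. -/
theorem stateAverage_eq_birkhoffAverage (ψ : E →L[𝕜] E) (s : E) (t : ℕ) :
    stateAverage ψ s t = birkhoffAverage 𝕜 ψ id t (ψ s) := by
  rw [stateAverage, birkhoffAverage, birkhoffSum, Finset.range_eq_Ico,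
    ← Finset.Ico_add_one_right_eq_Icc, Finset.sum_Ico_eq_sum_range, Finset.range_eq_Ico]
  congr 1
  refine Finset.sum_congr (by simp) fun m _ => ?_
  rw [state, add_comm, pow_succ, mul_apply_eq_comp, FunLike.coe_pow_eq_iterate, id]

theorem stateAverage_mem_evolutionSpace (ψ : E →L[𝕜] E) (s : E) (t : ℕ) :
    stateAverage ψ s t ∈ evolutionSpace ψ s :=
  Submodule.smul_mem _ _ <| Submodule.sum_mem _ fun m _ => Submodule.subset_span ⟨m, rfl⟩

theorem isMeanErgodic_of_tendsto {ψ : E →L[𝕜] E} {s x : E}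
    (h : Tendsto (stateAverage ψ s) atTop (𝓝 x)) : IsMeanErgodic ψ s :=
  ⟨x, mem_closure_of_tendsto h
    (Eventually.of_forall fun t => stateAverage_mem_evolutionSpace ψ s t), h⟩

theorem state_succ_eq (ψ : E →L[𝕜] E) (s : E) (t : ℕ) :
    state ψ s (t + 1) =
      ((t + 1 : ℕ) : 𝕜) • stateAverage ψ s (t + 1) - (t : 𝕜) • stateAverage ψ s t := by
  have h (n : ℕ) : (n : 𝕜) • stateAverage ψ s n = ∑ m ∈ Finset.Icc 1 n, state ψ s m := by
    rcases eq_or_ne n 0 with rfl | hn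
    · simp
    · rw [stateAverage, smul_inv_smul₀ (Nat.cast_ne_zero.2 hn)]
  rw [h, h, Finset.sum_Icc_succ_top (by omega), add_sub_cancel_left]

/-- The states of a mean ergodic evolution grow at most linearly. -/
theorem IsMeanErgodic.exists_norm_state_le {ψ : E →L[𝕜] E} {s : E} (h : IsMeanErgodic ψ s) :
    ∃ C : ℝ, 0 ≤ C ∧ ∀ t : ℕ, ‖state ψ s t‖ ≤ C * (t + 1) := by
  obtain ⟨x, -, hx⟩ := h
  obtain ⟨C, hC⟩ := hx.norm.bddAbove_range
  replace hC (t : ℕ) : ‖stateAverage ψ s t‖ ≤ C := hC ⟨t, rfl⟩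
  have hC0 : 0 ≤ C := (norm_nonneg _).trans (hC 0)
  -- `2 * C` bounds the difference of two scaled averages; `‖s‖` covers `t = 0`.
  refine ⟨2 * C + ‖s‖, by positivity, fun t => ?_⟩
  rcases t with _ | t
  · simp [state, hC0]
  · have : ‖state ψ s (t + 1)‖ ≤ (t + 1) * C + t * C := by
      rw [state_succ_eq]
      refine (norm_sub_le _ _).trans ?_
      rw [norm_smul, norm_smul, RCLike.norm_natCast, RCLike.norm_natCast, Nat.cast_add_one]
      gcongr <;> exact hC _
    push_cast
    nlinarith [mul_nonneg (norm_nonneg s) (Nat.cast_nonneg (α := ℝ) t), norm_nonneg s]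

/-- The subspace of vectors with bounded orbit. -/
def boundedOrbits (ψ : E →L[𝕜] E) : Submodule 𝕜 E where
  carrier := {x | ∃ C : ℝ, ∀ n : ℕ, ‖(ψ ^ n) x‖ ≤ C}
  add_mem' := by
    rintro x y ⟨C, hC⟩ ⟨D, hD⟩
    refine ⟨C + D, fun n => ?_⟩
    rw [map_add]
    exact norm_add_le_of_le (hC n) (hD n)
  zero_mem' := ⟨0, fun n => by simp⟩
  smul_mem' := by
    rintro a x ⟨C, hC⟩
    refine ⟨‖a‖ * C, fun n => ?_⟩
    rw [map_smul, norm_smul]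
    gcongr
    exact hC n

theorem apply_mem_boundedOrbits {ψ : E →L[𝕜] E} {x : E} (hx : x ∈ boundedOrbits ψ) :
    ψ x ∈ boundedOrbits ψ := by
  obtain ⟨C, hC⟩ := hx
  exact ⟨C, fun n => by simpa [pow_succ] using hC (n + 1)⟩

theorem IsStable.mem_boundedOrbits {ψ : E →L[𝕜] E} {s : E} (h : IsStable ψ s) :
    s ∈ boundedOrbits ψ := by
  obtain ⟨c, hc⟩ := isStable_iff.1 h
  exact ⟨c * ‖s‖, hc⟩

end Normed

section Hilbert

variable {𝕜 H : Type*} [RCLike 𝕜] [NormedAddCommGroup H] [InnerProductSpace 𝕜 H] [CompleteSpace H]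
  {ψ : H →L[𝕜] H}

/-- Cauchy–Schwarz for `⟪x, ψ* ψ x⟫`, where normality gives `‖ψ* ψ x‖ = ‖ψ ψ x‖`. -/
theorem norm_apply_sq_le_of_isStarNormal (hψ : IsStarNormal ψ) (x : H) :
    ‖ψ x‖ ^ 2 ≤ ‖x‖ * ‖ψ (ψ x)‖ := by
  rw [ContinuousLinearMap.isStarNormal_iff_norm_eq_adjoint.1 hψ (ψ x),
    ← inner_self_eq_norm_sq (𝕜 := 𝕜), ← ContinuousLinearMap.adjoint_inner_right]
  exact re_inner_le_norm _ _

/-- A normal operator does not increase the norm of a vector whose orbit grows at most linearly. -/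
theorem norm_apply_le_of_linear_growth (hψ : IsStarNormal ψ) {x : H} {C : ℝ}
    (hC : ∀ n : ℕ, ‖(ψ ^ n) x‖ ≤ C * (n + 1)) : ‖ψ x‖ ≤ ‖x‖ := by
  simpa using one_le_zero_of_logConvex_of_linear (a := fun n => ‖(ψ ^ n) x‖)
    (fun _ => norm_nonneg _)
    (fun n => by simpa [pow_succ'] using norm_apply_sq_le_of_isStarNormal hψ ((ψ ^ n) x)) hC

theorem norm_apply_le_of_mem_closure_boundedOrbits (hψ : IsStarNormal ψ) {x : H}
    (hx : x ∈ (boundedOrbits ψ).topologicalClosure) : ‖ψ x‖ ≤ ‖x‖ := by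
  refine closure_minimal (t := {x | ‖ψ x‖ ≤ ‖x‖}) ?_
    (isClosed_le ψ.continuous.norm continuous_norm) hx
  rintro y ⟨C, hC⟩
  refine norm_apply_le_of_linear_growth hψ (C := C) fun n => (hC n).trans ?_
  have : 0 ≤ C := (norm_nonneg _).trans (hC 0)
  nlinarith [mul_nonneg this (Nat.cast_nonneg (α := ℝ) n)]

/-- A mean ergodic evolution of a normal operator is stable. -/
theorem IsMeanErgodic.isStable (hψ : IsStarNormal ψ) {s : H} (h : IsMeanErgodic ψ s) :
    IsStable ψ s := by
  obtain ⟨C, hC0, hC⟩ := h.exists_norm_state_le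
  refine isStable_iff.2 ⟨1, fun t => ?_⟩
  rw [one_mul]
  induction t with
  | zero => simp [state]
  | succ t ih =>
    refine le_trans ?_ ih
    rw [state, pow_succ', mul_apply_eq_comp]
    -- The shifted orbit still grows linearly: `n + t + 1 ≤ (t + 1) * (n + 1)`.
    refine norm_apply_le_of_linear_growth hψ (C := C * (t + 1)) fun n => ?_
    rw [← mul_apply_eq_comp, ← pow_add]
    refine (hC (n + t)).trans ?_
    rw [mul_assoc]
    gcongr
    push_cast
    nlinarith [mul_nonneg (Nat.cast_nonneg (α := ℝ) t) (Nat.cast_nonneg (α := ℝ) n)]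

/-- The mean ergodic theorem for a normal operator at a vector with bounded orbit. -/
theorem exists_tendsto_stateAverage (hψ : IsStarNormal ψ) {s : H} (hs : s ∈ boundedOrbits ψ) :
    ∃ p ∈ fixedSpace ψ, Tendsto (stateAverage ψ s) atTop (𝓝 p) := by
  -- The closure is taken for completeness; the contraction bound survives the limit.
  set K := (boundedOrbits ψ).topologicalClosure
  have hmaps : ∀ x ∈ K, ψ x ∈ K := fun x hx =>
    map_mem_closure ψ.continuous hx fun _ => apply_mem_boundedOrbits
  have : CompleteSpace K := (Submodule.isClosed_topologicalClosure _).completeSpace_coe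
  let f : K →L[𝕜] K := ψ.restrict hmaps
  have hf : ‖f‖ ≤ 1 := f.opNorm_le_bound zero_le_one fun x => by
    simpa [f] using norm_apply_le_of_mem_closure_boundedOrbits hψ x.2
  let y : K := ⟨ψ s, hmaps s (subset_closure hs)⟩
  have hlim := f.tendsto_birkhoffAverage_orthogonalProjection hf y
  set q := (f.eqLocus (1 : K →L[𝕜] K)).orthogonalProjectionOnto y
  refine ⟨((q : K) : H), congrArg Subtype.val (q.2 : f q = q), ?_⟩
  have hcoe := (continuous_subtype_val.tendsto (q : K)).comp hlim
  refine hcoe.congr fun t => ?_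
  have hiter (n : ℕ) (z : K) : ((f^[n] z : K) : H) = ψ^[n] z := by
    induction n generalizing z with
    | zero => rfl
    | succ n ih => exact ih (f z)
  rw [stateAverage_eq_birkhoffAverage]
  simp [birkhoffAverage, birkhoffSum, hiter, y]

theorem inner_state_of_mem_fixedSpace (hψ : IsStarNormal ψ) {w : H} (hw : w ∈ fixedSpace ψ)
    (s : H) (t : ℕ) : inner 𝕜 (state ψ s t) w = inner 𝕜 s w := by
  have hadj : ContinuousLinearMap.adjoint ψ w = w := by
    -- A normal operator and its adjoint have the same kernel; apply this to `ψ - 1`.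
    have hn : IsStarNormal (ψ - 1) := ⟨by
      have := hψ.star_comm_self
      simp only [star_sub, star_one]
      exact (this.sub_right (Commute.one_right _)).sub_left (Commute.one_left _)⟩
    have h := (ContinuousLinearMap.IsStarNormal.adjoint_apply_eq_zero_iff hn w).2 (sub_eq_zero.2 hw)
    rw [← ContinuousLinearMap.star_eq_adjoint, star_sub, star_one] at h
    exact sub_eq_zero.1 h
  induction t with
  | zero => simp [state]
  | succ t ih =>
    rw [state, pow_succ', mul_apply_eq_comp, ← ContinuousLinearMap.adjoint_inner_right,
      hadj]
    exact ih

theorem eq_starProjection_of_tendsto_stateAverage (hψ : IsStarNormal ψ) {s p : H}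
    (hp : p ∈ fixedSpace ψ) (h : Tendsto (stateAverage ψ s) atTop (𝓝 p)) :
    (fixedSpace ψ).starProjection s = p := by
  refine Submodule.eq_starProjection_of_mem_of_inner_eq_zero hp fun w hw => ?_
  rw [inner_sub_left, sub_eq_zero]
  refine tendsto_nhds_unique ?_ (h.inner (tendsto_const_nhds (x := w)))
  refine tendsto_const_nhds.congr' ?_
  -- The average at `t = 0` is the junk value 0; for all other `t` its inner product with `w` is
  -- that of `s`.
  filter_upwards [eventually_ne_atTop 0] with t ht
  rw [stateAverage, inner_smul_left, sum_inner,
    Finset.sum_congr rfl fun m _ => inner_state_of_mem_fixedSpace hψ hw s m]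
  have : (t : 𝕜) ≠ 0 := Nat.cast_ne_zero.2 ht
  simp [this]

theorem IsStable.tendsto_stateAverage (hψ : IsStarNormal ψ) {s : H} (h : IsStable ψ s) :
    Tendsto (stateAverage ψ s) atTop (𝓝 ((fixedSpace ψ).starProjection s)) := by
  obtain ⟨p, hp, hlim⟩ := exists_tendsto_stateAverage hψ h.mem_boundedOrbits
  rwa [eq_starProjection_of_tendsto_stateAverage hψ hp hlim]

end Hilbert

end Evolution

theorem mainTheorem3 {𝕜 H : Type*} [RCLike 𝕜] [NormedAddCommGroup H] [InnerProductSpace 𝕜 H]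
    [CompleteSpace H] (ψ : H →L[𝕜] H) (hψ : IsStarNormal ψ) (s : H) :
    (Evolution.IsStable ψ s ↔ Evolution.IsMeanErgodic ψ s) ∧
      (Evolution.IsStable ψ s →
        Filter.Tendsto (Evolution.stateAverage ψ s) Filter.atTop
          (nhds ((Evolution.fixedSpace ψ).starProjection s))) :=
  ⟨⟨fun h => Evolution.isMeanErgodic_of_tendsto (h.tendsto_stateAverage hψ),
    fun h => h.isStable hψ⟩, fun h => h.tendsto_stateAverage hψ⟩
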